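/- **Theorem 2.1.** A mass distribution on $\mathbb{R}^n$ is a finite positive Borel measure that is absolutely continuous with respect to Lebesgue measure. For $k\ge 1$ let $V_k(\mathbb{R}^n)$ be the Stiefel manifold of orthonormal $k$-frames in $\mathbb{R}^n$, let $\mathbb{Z}_2$ act on it by $(v_1,\dots,v_k)\mapsto(-v_1,\dots,-v_k)$, and let $V_k(\mathbb{R}^n)/\mathbb{Z}_2\to \mathbb{R}P^{n-1}$ be the bundle induced by $(v_1,\dots,v_k)\mapsto v_1$. Let $\rho(2;\mathbb{R},n)$ denote the largest $k\ge 1$ for which this bundle has a continuous section. Let $m,n\ge 1$ be integers and put $$k=\min\left\{\rho(2;\mathbb{R},n),\ \left\lfloor\frac{n-1}{m-1}\right\rfloor\right\},$$ where the second term is read as $+\infty$ if $m=1$. Then for any $m$ mass distributions $\mu_1,\dots,\mu_m$ on $\mathbb{R}^n$ there are $k$ hyperplanes $H_1,\dots,H_k$ in $\mathbb{R}^n$ with pairwise orthogonal normal vectors, each of which bisects each of the measures: both closed half-spaces bounded by $H_i$ have $\mu_j$-measure $\tfrac12\mu_j(\mathbb{R}^n)$, for all $i$ and $j$. Equivalently,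 $\Omega^\perp(2;m,n)\ge k$, where $\Omega^\perp(2;m,n)$ is the largest number $l$ such that any $m$ mass distributions on $\mathbb{R}^n$ admit $l$ pairwise orthogonal hyperplanes each bisecting all of them. -/

import Mathlib

open MeasureTheory

noncomputable section

namespace OrthogonalBisection

/-- `ℝⁿ` with its Euclidean structure. -/
abbrev E (n : ℕ) : Type := EuclideanSpace ℝ (Fin n)

/-- The unit sphere `S^{n-1}` of `ℝⁿ`. -/
abbrev Sphere (n : ℕ) : Type := Metric.sphere (0 : E n) 1

/-! ### Quotients by the antipodal `ℤ/2`-action, and the Stiefel bundle -/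

/-- The orbit relation of the `ℤ/2`-action `x ↦ -x`. -/
def antipodalSetoid (X : Type) [InvolutiveNeg X] : Setoid X where
  r x y := y = x ∨ y = -x
  iseqv :=
    { refl := fun _ => Or.inl rfl
      symm := by
        rintro x y (h | h)
        · exact Or.inl h.symm
        · exact Or.inr (by rw [h, neg_neg])
      trans := by
        rintro x y z (h | h) (h' | h')
        · exact Or.inl (h'.trans h)
        · exact Or.inr (by rw [h', h])
        · exact Or.inr (by rw [h', h])
        · exact Or.inl (by rw [h', h, neg_neg]) }

/-- The orbit space `X / ℤ₂`; as a `Quotient` it carries the quotient topology. -/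
abbrev ModAntipode (X : Type) [InvolutiveNeg X] : Type := Quotient (antipodalSetoid X)

/-- Real projective space `ℝP^{n-1} = S^{n-1} / ℤ₂`. -/
abbrev RP (n : ℕ) : Type := ModAntipode (Sphere n)

/-- The Stiefel manifold `V_k(ℝⁿ)` of orthonormal `k`-frames, with the topology induced
from the `k`-fold product. -/
abbrev Stiefel (k n : ℕ) : Type := {v : Fin k → E n // Orthonormal ℝ v}

theorem orthonormal_neg {k n : ℕ} {v : Fin k → E n} (hv : Orthonormal ℝ v) :
    Orthonormal ℝ (-v) := by
  refine ⟨fun i => ?_, fun i j hij => ?_⟩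
  · simpa using hv.1 i
  · simpa using hv.2 hij

/-- The diagonal antipodal action `(v₁, …, v_k) ↦ (-v₁, …, -v_k)` on `V_k(ℝⁿ)`. -/
instance (k n : ℕ) : InvolutiveNeg (Stiefel k n) where
  neg v := ⟨-v.1, orthonormal_neg v.2⟩
  neg_neg v := Subtype.ext (neg_neg v.1)

/-- The projection `V_k(ℝⁿ) → S^{n-1}` of a frame onto its first vector. -/
def stiefelProj {k : ℕ} (hk : 0 < k) (n : ℕ) (v : Stiefel k n) : Sphere n :=
  ⟨v.1 ⟨0, hk⟩, by simpa using v.2.1 ⟨0, hk⟩⟩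

theorem stiefelProj_neg {k : ℕ} (hk : 0 < k) (n : ℕ) (v : Stiefel k n) :
    stiefelProj hk n (-v) = -stiefelProj hk n v := rfl

/-- The induced projection `V_k(ℝⁿ)/ℤ₂ → ℝP^{n-1}`. -/
def stiefelBundle {k : ℕ} (hk : 0 < k) (n : ℕ) : ModAntipode (Stiefel k n) → RP n :=
  Quotient.map (stiefelProj hk n) (by
    rintro v w (h | h)
    · exact Or.inl (by rw [h])
    · exact Or.inr (by rw [h, stiefelProj_neg]))

/-- The bundle `V_k(ℝⁿ)/ℤ₂ → ℝP^{n-1}` admits a (continuous) section; `k ≥ 1` is part of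
the condition, since the bundle is only defined then. -/
def HasSection (k n : ℕ) : Prop :=
  ∃ hk : 0 < k, ∃ σ : RP n → ModAntipode (Stiefel k n),
    Continuous σ ∧ ∀ p, stiefelBundle hk n (σ p) = p

/-- `ρ(2; ℝ, n)`: the largest `k` for which `V_k(ℝⁿ)/ℤ₂ → ℝP^{n-1}` has a section.
For `n ≥ 1` this maximum is attained, see `isGreatest_rho`. -/
def rho (n : ℕ) : ℕ := sSup {k | HasSection k n}

theorem hasSection_one (n : ℕ) : HasSection 1 n := by
  have horth : ∀ x : Sphere n, Orthonormal ℝ (fun _ : Fin 1 => (x : E n)) := fun x =>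
    ⟨fun _ => by simp, fun i j hij => absurd (Subsingleton.elim i j) hij⟩
  let f : Sphere n → Stiefel 1 n := fun x => ⟨fun _ => x, horth x⟩
  have hf : Continuous f :=
    Continuous.subtype_mk (continuous_pi fun _ => continuous_subtype_val) _
  refine ⟨one_pos, Quotient.map f ?_, ?_, ?_⟩
  · rintro x y (h | h)
    · exact Or.inl (by rw [h])
    · refine Or.inr (Subtype.ext ?_)
      funext i
      simp only [f, h]
      rfl
  · exact hf.quotient_map' _
  · rintro ⟨x⟩
    rfl

theorem HasSection.le {k n : ℕ} (hn : 1 ≤ n) (h : HasSection k n) : k ≤ n := by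
  obtain ⟨-, σ, -⟩ := h
  let x : Sphere n := ⟨EuclideanSpace.single ⟨0, hn⟩ 1, by simp⟩
  obtain ⟨v, -⟩ := Quotient.exists_rep (σ (Quotient.mk _ x))
  simpa using v.2.linearIndependent.fintype_card_le_finrank

theorem isGreatest_rho {n : ℕ} (hn : 1 ≤ n) : IsGreatest {k | HasSection k n} (rho n) :=
  have hb : BddAbove {k | HasSection k n} := ⟨n, fun _ h => h.le hn⟩
  ⟨Nat.sSup_mem ⟨1, hasSection_one n⟩ hb, fun _ h => le_csSup hb h⟩

/-! ### Mass distributions and hyperplanes -/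

/-- A mass distribution: a finite Borel measure on `ℝⁿ` that is absolutely continuous with
respect to Lebesgue measure. -/
structure IsMassDistribution {n : ℕ} (μ : Measure (E n)) : Prop where
  finite : IsFiniteMeasure μ
  absolutelyContinuous : μ ≪ volume

/-- A hyperplane `{u | ⟪u, a⟫ = b}`, presented by a unit normal vector `a` and `b : ℝ`
(a pair that the hyperplane determines up to a common sign). -/
structure Hyperplane (n : ℕ) where
  normal : Sphere n
  offset : ℝ

namespace Hyperplane

variable {n : ℕ}

/-- The underlying set of points. -/
def carrier (H : Hyperplane n) : Set (E n) := {u | inner ℝ u H.normal.1 = H.offset}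

/-- The half-space `H⁺`. -/
def posSide (H : Hyperplane n) : Set (E n) := {u | H.offset ≤ inner ℝ u H.normal.1}

/-- The half-space `H⁻`. -/
def negSide (H : Hyperplane n) : Set (E n) := {u | inner ℝ u H.normal.1 ≤ H.offset}

/-- `H` bisects `μ`: each half-space has half of the total measure. -/
def Bisects (H : Hyperplane n) (μ : Measure (E n)) : Prop :=
  μ H.posSide = μ Set.univ / 2 ∧ μ H.negSide = μ Set.univ / 2

/-- Two hyperplanes are orthogonal if their normal vectors are. -/
def Orthogonal (H K : Hyperplane n) : Prop := inner ℝ H.normal.1 K.normal.1 = 0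

end Hyperplane

/-- Any `m` mass distributions on `ℝⁿ` admit `k` pairwise orthogonal hyperplanes, each of
which bisects each of the measures. -/
def OrthogonallyBisectable (k m n : ℕ) : Prop :=
  ∀ μ : Fin m → Measure (E n), (∀ j, IsMassDistribution (μ j)) →
    ∃ H : Fin k → Hyperplane n,
      (∀ i i', i ≠ i' → (H i).Orthogonal (H i')) ∧ ∀ i j, (H i).Bisects (μ j)

/-- `Ω^⊥(2; m, n)`: the maximum `k` such that any `m` mass distributions on `ℝⁿ` are each
bisected by `k` pairwise orthogonal hyperplanes. This maximum is attained, see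
`isGreatest_omegaPerp`. -/
def omegaPerp (m n : ℕ) : ℕ := sSup {k | OrthogonallyBisectable k m n}

theorem OrthogonallyBisectable.le {k m n : ℕ} (h : OrthogonallyBisectable k m n) : k ≤ n := by
  obtain ⟨H, hH, -⟩ := h (fun _ => 0) fun _ =>
    ⟨inferInstance, Measure.AbsolutelyContinuous.zero _⟩
  have ho : Orthonormal ℝ fun i => (H i).normal.1 :=
    ⟨fun i => by simp, fun i j hij => hH i j hij⟩
  simpa using ho.linearIndependent.fintype_card_le_finrank

theorem isGreatest_omegaPerp (m n : ℕ) :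
    IsGreatest {k | OrthogonallyBisectable k m n} (omegaPerp m n) :=
  have hb : BddAbove {k | OrthogonallyBisectable k m n} := ⟨n, fun _ h => h.le⟩
  ⟨Nat.sSup_mem ⟨0, fun _ _ => ⟨Fin.elim0, fun i => i.elim0, fun i => i.elim0⟩⟩ hb,
    fun _ h => le_csSup hb h⟩

end OrthogonalBisection

end

/-! A section of the Stiefel bundle lifts to an odd continuous field x ↦ (f₁(x), …, f_k(x)) of
orthonormal frames on S^{n-1}. If one measure had a unique bisecting hyperplane in each direction u,
its offset β(u) would be continuous and odd. The imbalances of the other m - 1 measures across the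
hyperplanes with normals f_i(x) and offsets β(f_i(x)) would then form an odd map from S^{n-1} to
ℝ^{k(m-1)}. Since k(m-1) < n, Borsuk–Ulam gives a zero, and the k hyperplanes at that x bisect
everything.

Medians need not be unique, so the equation for β is tilted by a term εb (`exists_approx_median`).
The first measure is then bisected only up to an error of order ε, and compactness removes the error
(`orthogonallyBisectable_of_frame`).

Borsuk–Ulam is proved from Fan's combinatorial argument. An odd map to ℝ^d without zeros labels each
point by its largest coordinate and the sign of that coordinate. On simplices of small mesh, the
indicator cochains of alternating labels satisfy the identity `coboundary_fan`. Paired with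
hemisphere chains built by iterated coning (`exists_chain`), they force an alternating simplex with
d + 1 distinct indices among d. -/

/-! ### Ordered cochains modulo two -/

namespace OrderedCochain

variable {V W : Type*}

/-- The mod-two coboundary of a cochain on (finite lists of) vertices. -/
def coboundary : (List V → ZMod 2) → List V → ZMod 2
  | _, [] => 0
  | F, v :: l => F l + coboundary (fun l' => F (v :: l')) l

/-- The dual of the prism operator between the vertex maps `f` and `g`. -/
def prism (f g : V → W) : (List W → ZMod 2) → List V → ZMod 2
  | _, [] => 0
  | F, v :: l => F (f v :: g v :: l.map g) + prism f g (fun l' => F (f v :: l')) l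

theorem coboundary_congr {F F' : List V → ZMod 2} {l : List V}
    (h : ∀ l', l'.Sublist l → F l' = F' l') : coboundary F l = coboundary F' l := by
  induction l generalizing F F' with
  | nil => rfl
  | cons v l ih =>
    simp only [coboundary]
    rw [h l (List.sublist_cons_self v l), ih fun l' hl' => h _ (hl'.cons_cons v)]

theorem coboundary_zero (l : List V) : coboundary (fun _ => 0) l = 0 := by
  induction l with
  | nil => rfl
  | cons v l ih => simp only [coboundary, ih, add_zero]

theorem coboundary_add (F G : List V → ZMod 2) (l : List V) :
    coboundary (fun l' => F l' + G l') l = coboundary F l + coboundary G l := by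
  induction l generalizing F G with
  | nil => simp [coboundary]
  | cons v l ih => simp only [coboundary, ih]; ring

theorem coboundary_map (f : V → W) (F : List W → ZMod 2) (l : List V) :
    coboundary F (l.map f) = coboundary (fun l' => F (l'.map f)) l := by
  induction l generalizing F with
  | nil => rfl
  | cons v l ih => simp only [coboundary, List.map_cons, ih]

theorem coboundary_perm {F : List V → ZMod 2} (hF : ∀ l l', l.Perm l' → F l = F l')
    {l l' : List V} (h : l.Perm l') : coboundary F l = coboundary F l' := by
  induction h generalizing F with
  | nil => rfl
  | cons v h ih =>
    simp only [coboundary]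
    rw [hF _ _ h, ih fun _ _ h' => hF _ _ (h'.cons v)]
  | swap v w l =>
    simp only [coboundary]
    rw [show (fun l' => F (w :: v :: l')) = fun l' => F (v :: w :: l') from
      funext fun l' => hF _ _ (List.Perm.swap v w l')]
    ring
  | trans _ _ ih₁ ih₂ => exact (ih₁ hF).trans (ih₂ hF)

theorem prism_add (f g : V → W) (F G : List W → ZMod 2) (l : List V) :
    prism f g (fun l' => F l' + G l') l = prism f g F l + prism f g G l := by
  induction l generalizing F G with
  | nil => simp [prism]
  | cons v l ih => simp only [prism, ih]; ring

theorem prism_congr {f g : V → W} {F F' : List W → ZMod 2} {l : List V}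
    (h : ∀ l', l'.length = l.length + 1 → (∀ w ∈ l', ∃ v ∈ l, w = f v ∨ w = g v) →
      F l' = F' l') : prism f g F l = prism f g F' l := by
  induction l generalizing F F' with
  | nil => rfl
  | cons v l ih =>
    simp only [prism]
    congr 1
    · refine h _ (by simp) ?_
      intro w hw
      simp only [List.mem_cons, List.mem_map] at hw
      rcases hw with rfl | rfl | ⟨u, hu, rfl⟩
      · exact ⟨v, by simp, Or.inl rfl⟩
      · exact ⟨v, by simp, Or.inr rfl⟩
      · exact ⟨u, by simp [hu], Or.inr rfl⟩
    · refine ih fun l' hl hl' => h _ (by simp [hl]) ?_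
      intro w hw
      rcases List.mem_cons.1 hw with rfl | hw
      · exact ⟨v, by simp, Or.inl rfl⟩
      · obtain ⟨u, hu, h'⟩ := hl' w hw
        exact ⟨u, by simp [hu], h'⟩

/-- The prism operator is a cochain homotopy between the pullbacks along `f` and `g`. -/
theorem prism_coboundary (f g : V → W) (F : List W → ZMod 2) (l : List V) :
    prism f g (coboundary F) l =
      coboundary (prism f g F) l + (F (l.map f) + F (l.map g)) := by
  induction l generalizing F with
  | nil => simp [prism, coboundary, CharTwo.add_self_eq_zero]
  | cons v l ih =>
    simp only [prism, coboundary, List.map_cons, prism_add, coboundary_add, ih]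
    rw [coboundary_map g]
    have h := CharTwo.add_self_eq_zero (F (f v :: l.map g))
    linear_combination h

end OrderedCochain

/-! ### Fan's alternating labels -/

namespace FanLabel

open OrderedCochain

variable {ι : Type*} [LinearOrder ι]

/-- The opposite of a signed label. -/
def opp (x : ι ×ₗ Bool) : ι ×ₗ Bool := toLex ((ofLex x).1, !(ofLex x).2)

/-- A list of labels contains no pair of opposite labels. -/
def Consistent (l : List (ι ×ₗ Bool)) : Prop :=
  ∀ x ∈ l, ∀ y ∈ l, (ofLex x).1 = (ofLex y).1 → x = y

/-- The indicator of the lists whose indices increase strictly and whose signs alternate,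
starting with `s`. -/
def alt : Bool → List (ι ×ₗ Bool) → ZMod 2
  | _, [] => 1
  | s, x :: l =>
    if (ofLex x).2 = s ∧ ∀ y ∈ l, (ofLex x).1 < (ofLex y).1 then alt (!s) l else 0

/-- Fan's parity count. An alternating list has exactly one alternating facet with initial sign s:
drop the last label if the list starts with s, the first otherwise. A list that does not alternate
has an even number of such facets. -/
theorem coboundary_alt {l : List (ι ×ₗ Bool)} (hs : l.Pairwise (· ≤ ·)) (hc : Consistent l)
    (s : Bool) : coboundary (alt s) l = alt s l + alt (!s) l := by
  induction l generalizing s with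
  | nil => simp [coboundary, alt, CharTwo.add_self_eq_zero]
  | cons x l ih =>
    rw [List.pairwise_cons] at hs
    have hc' : Consistent l := fun a ha b hb =>
      hc a (List.mem_cons_of_mem _ ha) b (List.mem_cons_of_mem _ hb)
    simp only [coboundary]
    by_cases hlt : ∀ y ∈ l, (ofLex x).1 < (ofLex y).1
    · by_cases hx : (ofLex x).2 = s
      · have h1 : coboundary (fun l' => alt s (x :: l')) l = coboundary (alt (!s)) l :=
          coboundary_congr fun l' hl' => by
            rw [alt, if_pos ⟨hx, fun y hy => hlt y (hl'.subset hy)⟩]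
        have h2 : alt s (x :: l) = alt (!s) l := by rw [alt, if_pos ⟨hx, hlt⟩]
        have h3 : alt (!s) (x :: l) = 0 := by
          rw [alt, if_neg]; rintro ⟨h, -⟩; rw [hx] at h; cases s <;> simp at h
        rw [h1, h2, h3, ih hs.2 hc', Bool.not_not]
        linear_combination CharTwo.add_self_eq_zero (alt s l)
      · have hx' : (ofLex x).2 = !s := by
          cases s <;> cases h : (ofLex x).2 <;> simp_all
        have h1 : (fun l' => alt s (x :: l')) = fun _ => 0 := funext fun l' => by
          rw [alt, if_neg fun h => hx h.1]
        have h2 : alt s (x :: l) = 0 := congrFun h1 l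
        have h3 : alt (!s) (x :: l) = alt s l := by
          rw [alt, if_pos ⟨hx', hlt⟩, Bool.not_not]
        rw [h1, coboundary_zero, h2, h3]; ring
    · have hall : ∀ t, alt t (x :: l) = 0 := fun t => by
        rw [alt, if_neg fun h => hlt h.2]
      rw [hall, hall]
      cases l with
      | nil => simp at hlt
      | cons y l =>
        -- By sortedness and consistency, an index tie at the head means that the label is repeated.
        -- Deleting either copy leaves the same list, and every other facet keeps both copies and
        -- does not alternate.
        have hxy : x = y := by
          by_contra hne
          apply hlt
          intro z hz
          have hxz := hs.1 z hz
          rcases Prod.Lex.le_iff.1 hxz with h | ⟨h, -⟩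
          · exact h
          · have hz' := hc x (by simp) z (List.mem_cons_of_mem _ hz) h
            have hyz : y ≤ z := by
              rcases List.mem_cons.1 hz with rfl | hz
              · exact le_rfl
              · exact (List.pairwise_cons.1 hs.2).1 z hz
            exact absurd (le_antisymm (hs.1 y (by simp)) (hz' ▸ hyz)) hne
        subst hxy
        have h1 : (fun l' => alt s (x :: x :: l')) = fun _ => 0 := funext fun l' => by
          rw [alt, if_neg]; rintro ⟨-, h⟩; exact lt_irrefl _ (h x (by simp))
        simp only [coboundary, h1, coboundary_zero]
        rw [add_zero, CharTwo.add_self_eq_zero, add_zero]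

theorem alt_map_opp (s : Bool) (l : List (ι ×ₗ Bool)) : alt s (l.map opp) = alt (!s) l := by
  induction l generalizing s with
  | nil => rfl
  | cons x l ih =>
    simp only [List.map_cons, alt, ih, List.forall_mem_map]
    refine if_congr (and_congr ?_ Iff.rfl) rfl rfl
    show (!(ofLex x).2) = s ↔ _
    cases s <;> cases (ofLex x).2 <;> simp

theorem pairwise_of_alt_ne_zero {s : Bool} {l : List (ι ×ₗ Bool)} (h : alt s l ≠ 0) :
    l.Pairwise fun x y => (ofLex x).1 < (ofLex y).1 := by
  induction l generalizing s with
  | nil => simp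
  | cons x l ih =>
    rw [alt] at h
    split_ifs at h with hx
    · exact List.pairwise_cons.2 ⟨hx.2, ih h⟩
    · exact absurd rfl h

/-- The indicator of the lists of labels which, after sorting, have strictly increasing
indices and alternating signs. -/
noncomputable def fan (s : Bool) (l : List (ι ×ₗ Bool)) : ZMod 2 :=
  alt s (Multiset.sort (l : Multiset (ι ×ₗ Bool)) (· ≤ ·))

theorem perm_sort (l : List (ι ×ₗ Bool)) :
    (Multiset.sort (l : Multiset (ι ×ₗ Bool)) (· ≤ ·)).Perm l :=
  Multiset.coe_eq_coe.1 (Multiset.sort_eq _ _)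

theorem fan_perm (s : Bool) {l l' : List (ι ×ₗ Bool)} (h : l.Perm l') :
    fan s l = fan s l' := by
  rw [fan, fan, Multiset.coe_eq_coe.2 h]

theorem fan_eq_alt (s : Bool) {l : List (ι ×ₗ Bool)} (h : l.Pairwise (· ≤ ·)) :
    fan s l = alt s l := by
  rw [fan, (perm_sort l).eq_of_pairwise (fun _ _ _ _ => le_antisymm)
    (Multiset.pairwise_sort _ _) h]

/-- Sorting makes `fan` symmetric in its vertices, so its coboundary may be computed on the sorted
list, whose sublists are again sorted; there `coboundary_alt` applies. -/
theorem coboundary_fan {l : List (ι ×ₗ Bool)} (hc : Consistent l) (s : Bool) :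
    coboundary (fan s) l = fan s l + fan (!s) l := by
  have hp := perm_sort l
  have hs : (Multiset.sort (l : Multiset (ι ×ₗ Bool)) (· ≤ ·)).Pairwise (· ≤ ·) :=
    Multiset.pairwise_sort _ _
  rw [coboundary_perm (fun _ _ => fan_perm s) hp.symm,
    coboundary_congr fun l' hl' => fan_eq_alt s (hs.sublist hl'),
    coboundary_alt hs fun x hx y hy => hc x (hp.subset hx) y (hp.subset hy)]
  rfl

/-- Negation can reverse the order only between labels of equal index. In a consistent list these
coincide, so the negated sorted list is still sorted. -/
theorem fan_map_opp {l : List (ι ×ₗ Bool)} (hc : Consistent l) (s : Bool) :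
    fan s (l.map opp) = fan (!s) l := by
  have hp := perm_sort l
  have hs : (Multiset.sort (l : Multiset (ι ×ₗ Bool)) (· ≤ ·)).Pairwise (· ≤ ·) :=
    Multiset.pairwise_sort _ _
  rw [fan_perm s (hp.map opp).symm, fan_eq_alt, alt_map_opp]
  · rfl
  · rw [List.pairwise_map]
    refine hs.imp_of_mem fun {x y} hx hy hxy => ?_
    rcases Prod.Lex.le_iff.1 hxy with h | ⟨h, -⟩
    · exact Prod.Lex.le_iff.2 (Or.inl h)
    · rw [hc x (hp.subset hx) y (hp.subset hy) h]

theorem fan_singleton (x : ι ×ₗ Bool) : fan true [x] + fan false [x] = 1 := by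
  rw [fan_eq_alt _ (by simp), fan_eq_alt _ (by simp)]
  cases h : (ofLex x).2 <;> simp [alt, h]

theorem length_le_of_fan_ne_zero [Fintype ι] {s : Bool} {l : List (ι ×ₗ Bool)}
    (h : fan s l ≠ 0) : l.length ≤ Fintype.card ι := by
  have h1 := pairwise_of_alt_ne_zero h
  have h2 : ((Multiset.sort (l : Multiset (ι ×ₗ Bool)) (· ≤ ·)).map
      fun x => (ofLex x).1).Nodup := by
    rw [List.Nodup, List.pairwise_map]
    exact h1.imp fun h => h.ne
  have h3 := h2.length_le_card
  rwa [List.length_map, (perm_sort l).length_eq] at h3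

end FanLabel

/-! ### The Borsuk–Ulam theorem -/

namespace BorsukUlam

open OrderedCochain FanLabel

/-- `ℝⁿ` with the `ℓ¹`-norm. -/
abbrev L1 (n : ℕ) : Type := PiLp 1 fun _ : Fin n => ℝ

/-- The basis vector `e_j`. -/
noncomputable def basisVec {n : ℕ} (j : Fin n) : L1 n := WithLp.toLp 1 (Pi.single j 1)

/-- The straight homotopy from the identity to the constant map `p`. -/
noncomputable def slide {n : ℕ} (p : L1 n) (t : ℝ) (v : L1 n) : L1 n := (1 - t) • v + t • p

/-- `j`-simplices of mesh at most `2j/N` on the `ℓ¹`-unit sphere of `ℝ^{j+1}`. -/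
def Small (n N j : ℕ) (l : List (L1 n)) : Prop :=
  l.length = j + 1 ∧ (∀ v ∈ l, ‖v‖ = 1 ∧ ∀ i : Fin n, j < i → v i = 0) ∧
    ∀ v ∈ l, ∀ w ∈ l, ‖v - w‖ ≤ 2 * j / N

theorem norm_basisVec {n : ℕ} (j : Fin n) : ‖basisVec j‖ = 1 := by
  rw [PiLp.norm_eq_of_L1, Finset.sum_eq_single j] <;> simp +contextual [basisVec]

/-- This is why the ℓ¹-norm is used: v and the basis vector have disjoint supports, so the straight
segment between them stays on the sphere without normalisation. -/
theorem norm_slide {n : ℕ} {j : Fin n} {v : L1 n} (hv : ‖v‖ = 1) (hj : v j = 0) {t : ℝ}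
    (h0 : 0 ≤ t) (h1 : t ≤ 1) : ‖slide (basisVec j) t v‖ = 1 := by
  have h : ∀ i, ‖slide (basisVec j) t v i‖ = (1 - t) * ‖v i‖ + t * ‖basisVec j i‖ := by
    intro i
    simp only [slide, PiLp.add_apply, PiLp.smul_apply, smul_eq_mul, Real.norm_eq_abs]
    by_cases hi : i = j
    · subst hi
      simp [hj, abs_mul, abs_of_nonneg h0]
    · simp [basisVec, hi, abs_mul, abs_of_nonneg (sub_nonneg.2 h1)]
  rw [PiLp.norm_eq_of_L1, Finset.sum_congr rfl fun i _ => h i, Finset.sum_add_distrib,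
    ← Finset.mul_sum, ← Finset.mul_sum, ← PiLp.norm_eq_of_L1, ← PiLp.norm_eq_of_L1, hv,
    norm_basisVec]
  ring

theorem norm_slide_sub_le {n : ℕ} {p v w : L1 n} (hp : ‖p‖ = 1) (hw : ‖w‖ = 1) {t s : ℝ}
    (h0 : 0 ≤ t) (h1 : t ≤ 1) : ‖slide p t v - slide p s w‖ ≤ ‖v - w‖ + 2 * |t - s| := by
  have h : slide p t v - slide p s w = (1 - t) • (v - w) + (t - s) • (p - w) := by
    simp only [slide]; module
  have h2 : ‖p - w‖ ≤ 2 := (norm_sub_le _ _).trans (by rw [hp, hw]; norm_num)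
  rw [h]
  refine (norm_add_le _ _).trans ?_
  rw [norm_smul, norm_smul, Real.norm_eq_abs, Real.norm_eq_abs,
    abs_of_nonneg (sub_nonneg.2 h1)]
  have := mul_le_mul_of_nonneg_left h2 (abs_nonneg (t - s))
  have := mul_nonneg h0 (norm_nonneg (v - w))
  linarith

/-- The dual of the chain-level cone operator with apex `p`, through `N` thin prisms. -/
noncomputable def cone {n : ℕ} (N : ℕ) (p : L1 n) (F : List (L1 n) → ZMod 2)
    (l : List (L1 n)) : ZMod 2 :=
  ∑ i ∈ Finset.range N,
    prism (slide p ((i : ℝ) / N)) (slide p (((i + 1 : ℕ) : ℝ) / N)) F l +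
      F (p :: l.map fun _ => p)

theorem cone_add {n : ℕ} (N : ℕ) (p : L1 n) (F G : List (L1 n) → ZMod 2) :
    cone N p (F + G) = cone N p F + cone N p G := by
  funext l
  have h : ∀ i, _ = _ := fun i : ℕ =>
    prism_add (slide p ((i : ℝ) / N)) (slide p (((i + 1 : ℕ) : ℝ) / N)) F G l
  simp only [cone, Pi.add_apply]
  rw [show F + G = fun l' => F l' + G l' from rfl]
  simp only [h, Finset.sum_add_distrib]
  ring

theorem coboundary_sum {V : Type*} (s : Finset ℕ) (F : ℕ → List V → ZMod 2) (l : List V) :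
    coboundary (fun l' => ∑ i ∈ s, F i l') l = ∑ i ∈ s, coboundary (F i) l := by
  induction s using Finset.induction_on with
  | empty => simp [coboundary_zero]
  | insert a s ha ih => simp only [Finset.sum_insert ha, coboundary_add, ih]

/-- The prism homotopies telescope from the identity to the constant map p. The additional summand
of `cone` bounds the degenerate simplex (p, …, p) left at the far end. -/
theorem cone_coboundary {n N : ℕ} (hN : 0 < N) (p : L1 n) (F : List (L1 n) → ZMod 2)
    (l : List (L1 n)) : cone N p (coboundary F) l = coboundary (cone N p F) l + F l := by
  have hN' : (N : ℝ) ≠ 0 := by positivity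
  have htel : ∀ M : ℕ, ∑ i ∈ Finset.range M, (F (l.map (slide p ((i : ℝ) / N))) +
      F (l.map (slide p (((i + 1 : ℕ) : ℝ) / N)))) =
      F (l.map (slide p ((0 : ℕ) / N))) + F (l.map (slide p ((M : ℝ) / N))) := by
    intro M
    induction M with
    | zero => simp [CharTwo.add_self_eq_zero]
    | succ M ih =>
      rw [Finset.sum_range_succ, ih]
      linear_combination CharTwo.add_self_eq_zero (F (l.map (slide p ((M : ℝ) / N))))
  have h0 : l.map (slide p ((0 : ℕ) / N)) = l := by
    rw [show slide p (((0 : ℕ) : ℝ) / N) = id from funext fun v => by simp [slide]]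
    exact List.map_id l
  have h1 : slide p ((N : ℝ) / N) = fun _ => p := funext fun v => by
    simp [slide, div_self hN']
  have hsplit : coboundary (cone N p F) l =
      ∑ i ∈ Finset.range N, coboundary
        (prism (slide p ((i : ℝ) / N)) (slide p (((i + 1 : ℕ) : ℝ) / N)) F) l +
      coboundary (fun l' => F (p :: l'.map fun _ => p)) l := by
    rw [← coboundary_sum, ← coboundary_add]; rfl
  rw [hsplit]
  simp only [cone, prism_coboundary, Finset.sum_add_distrib (f := fun i => coboundary _ l)]
  rw [htel, h0, h1]
  simp only [coboundary]
  rw [coboundary_map (fun _ => p) (fun l' => F (p :: l'))]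
  linear_combination CharTwo.add_self_eq_zero (F (l.map fun _ => p))

theorem cone_congr {n N j : ℕ} (hN : 0 < N) (hj : j + 1 < n) {F F' : List (L1 n) → ZMod 2}
    (h : ∀ l, Small n N (j + 1) l → F l = F' l) {l : List (L1 n)} (hl : Small n N j l) :
    cone N (basisVec ⟨j + 1, hj⟩) F l = cone N (basisVec ⟨j + 1, hj⟩) F' l := by
  obtain ⟨hlen, hsph, hmesh⟩ := hl
  have hN' : (0 : ℝ) < N := by positivity
  have hp : ∀ i : Fin n, j + 1 < i → basisVec (⟨j + 1, hj⟩ : Fin n) i = 0 := fun i hi => by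
    have : i ≠ ⟨j + 1, hj⟩ := fun h => by rw [h] at hi; exact lt_irrefl _ hi
    simp [basisVec, this]
  rw [cone, cone]
  congr 1
  · refine Finset.sum_congr rfl fun i hi => prism_congr fun l' hlen' hl' => h _ ?_
    have hiN := Finset.mem_range.1 hi
    have key : ∀ w ∈ l', ∃ v ∈ l, ∃ t : ℝ, 0 ≤ t ∧ t ≤ 1 ∧ (i : ℝ) / N ≤ t ∧
        t ≤ (i : ℝ) / N + 1 / N ∧ w = slide (basisVec ⟨j + 1, hj⟩) t v := by
      intro w hw
      have hlt : (i : ℝ) + 1 ≤ N := by exact_mod_cast hiN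
      have hpos : (0 : ℝ) ≤ 1 / N := by positivity
      obtain ⟨v, hv, rfl | rfl⟩ := hl' w hw
      · exact ⟨v, hv, _, by positivity, by rw [div_le_one hN']; linarith, le_rfl,
          by linarith, rfl⟩
      · refine ⟨v, hv, _, by positivity, ?_, ?_, ?_, rfl⟩
        · rw [div_le_one hN']; push_cast; exact hlt
        · push_cast; rw [add_div]; linarith
        · push_cast; rw [add_div]
    refine ⟨by omega, fun w hw => ?_, fun w hw w' hw' => ?_⟩
    · obtain ⟨v, hv, t, h0, h1, -, -, rfl⟩ := key w hw
      refine ⟨norm_slide (hsph v hv).1 ((hsph v hv).2 _ (Nat.lt_succ_self j)) h0 h1,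
        fun i hi => ?_⟩
      simp [slide, hp i hi, (hsph v hv).2 i (by omega)]
    · obtain ⟨v, hv, t, h0, h1, ht, ht', rfl⟩ := key w hw
      obtain ⟨v', hv', s, -, -, hs, hs', rfl⟩ := key w' hw'
      refine (norm_slide_sub_le (norm_basisVec _) (hsph v' hv').1 h0 h1).trans ?_
      -- Vertices of one prism have parameters in a common interval of length 1/N, so coning raises
      -- the mesh bound from 2j/N to 2(j+1)/N.
      have h3 : |t - s| ≤ 1 / N := abs_le.2 ⟨by linarith, by linarith⟩
      have h4 := hmesh v hv v' hv'
      have h5 : (2 * ((j + 1 : ℕ) : ℝ) / N) = 2 * j / N + 2 * (1 / N) := by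
        push_cast; ring
      rw [h5]; linarith
  · refine h _ ⟨by simp [hlen], fun w hw => ?_, fun w hw w' hw' => ?_⟩
    · have : w = basisVec ⟨j + 1, hj⟩ := by
        rcases List.mem_cons.1 hw with h | h
        · exact h
        · obtain ⟨_, -, rfl⟩ := List.mem_map.1 h; rfl
      rw [this]
      exact ⟨norm_basisVec _, hp⟩
    · have : ∀ w ∈ basisVec (⟨j + 1, hj⟩ : Fin n) :: l.map fun _ => basisVec ⟨j + 1, hj⟩,
          w = basisVec ⟨j + 1, hj⟩ := by
        intro w hw
        rcases List.mem_cons.1 hw with h | h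
        · exact h
        · obtain ⟨_, -, rfl⟩ := List.mem_map.1 h; rfl
      rw [this w hw, this w' hw', sub_self, norm_zero]
      positivity

theorem Small.map_neg {n N j : ℕ} {l : List (L1 n)} (h : Small n N j l) :
    Small n N j (l.map fun v => -v) := by
  obtain ⟨h1, h2, h3⟩ := h
  refine ⟨by simp [h1], fun w hw => ?_, fun w hw w' hw' => ?_⟩
  · obtain ⟨v, hv, rfl⟩ := List.mem_map.1 hw
    refine ⟨by rw [norm_neg]; exact (h2 v hv).1, fun i hi => ?_⟩
    simp [(h2 v hv).2 i hi]
  · obtain ⟨v, hv, rfl⟩ := List.mem_map.1 hw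
    obtain ⟨v', hv', rfl⟩ := List.mem_map.1 hw'
    rw [neg_sub_neg, norm_sub_rev]
    exact h3 v hv v' hv'

/-- Hemisphere chains of small mesh, as functionals on cochains: an antipodal family of
cochains whose coboundary is its symmetrisation evaluates to `1` in every dimension. -/
theorem exists_chain {n N : ℕ} (hN : 0 < N) (a : Bool → List (L1 n) → ZMod 2)
    (ha : ∀ v, a true [v] + a false [v] = 1)
    (hneg : ∀ j < n, ∀ l, Small n N j l → ∀ s, a s (l.map fun v => -v) = a (!s) l)
    (hcob : ∀ j < n, ∀ l, Small n N j l → ∀ s, coboundary (a s) l = a s l + a (!s) l)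
    (j : ℕ) (hj : j < n) :
    ∃ c : (List (L1 n) → ZMod 2) →+ ZMod 2,
      (∀ F F', (∀ l, Small n N j l → F l = F' l) → c F = c F') ∧
      (∀ G, c (coboundary G) + c (fun l => coboundary G (l.map fun v => -v)) = 0) ∧
      c (a true + a false) = 1 := by
  induction j with
  | zero =>
    refine ⟨Pi.evalAddMonoidHom _ [basisVec ⟨0, hj⟩], fun F F' h => h _ ?_, fun G => ?_, ?_⟩
    · refine ⟨rfl, ?_, ?_⟩
      · intro v hv
        rw [List.mem_singleton.1 hv]
        refine ⟨norm_basisVec _, fun i hi => ?_⟩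
        have : i ≠ ⟨0, hj⟩ := fun h => by rw [h] at hi; exact lt_irrefl _ hi
        simp [basisVec, this]
      · intro v hv w hw
        rw [List.mem_singleton.1 hv, List.mem_singleton.1 hw]
        simp
    -- On a single vertex the coboundary of G is the constant G [], so a point and its antipode
    -- cancel modulo two.
    · simp [coboundary, CharTwo.add_self_eq_zero]
    · exact ha _
  | succ j ih =>
    obtain ⟨c, hloc, hcyc, hone⟩ := ih (by omega)
    let p : L1 n := basisVec ⟨j + 1, hj⟩
    let pull : (List (L1 n) → ZMod 2) →+ (List (L1 n) → ZMod 2) :=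
      { toFun := fun F l => F (l.map fun v => -v)
        map_zero' := rfl
        map_add' := fun _ _ => rfl }
    let K : (List (L1 n) → ZMod 2) →+ (List (L1 n) → ZMod 2) :=
      AddMonoidHom.mk' (cone N p) (cone_add N p)
    -- The hemisphere c and its antipode form the j-sphere z. Its cone z ∘ K is the next hemisphere,
    -- with boundary z because z is a cycle.
    let z := c + c.comp pull
    have hz : ∀ F, z F = c F + c (pull F) := fun F => rfl
    have hpp : ∀ F, pull (pull F) = F := fun F => funext fun l => by
      show F ((l.map fun v => -v).map fun v => -v) = F l
      simp
    have hpc : ∀ F, pull (coboundary F) = coboundary (pull F) := fun F => funext fun l =>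
      coboundary_map _ _ _
    have hzloc : ∀ F F', (∀ l, Small n N j l → F l = F' l) → z F = z F' := fun F F' h => by
      rw [hz, hz, hloc F F' h, hloc (pull F) (pull F') fun l hl => h _ hl.map_neg]
    have hbd : ∀ G, z (K (coboundary G)) = z G := fun G => by
      have h : K (coboundary G) = coboundary (K G) + G := funext (cone_coboundary hN p G)
      rw [h, map_add, show z (coboundary (K G)) = 0 from hcyc (K G), zero_add]
    refine ⟨z.comp K, fun F F' h => ?_, fun G => ?_, ?_⟩
    · exact hzloc _ _ fun l hl => cone_congr hN hj h hl
    · show z (K (coboundary G)) + z (K (pull (coboundary G))) = 0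
      rw [hpc, hbd, hbd, hz, hz, hpp, add_comm (c (pull G)), CharTwo.add_self_eq_zero]
    · have h1 : z (K (a true + a false)) = z (K (coboundary (a true))) :=
        hzloc _ _ fun l hl => cone_congr hN hj (fun l' hl' => (hcob _ hj l' hl' true).symm) hl
      show z (K (a true + a false)) = 1
      -- Stokes: on the new hemisphere the symmetrised cochain is the coboundary of `a true`. Its
      -- value is therefore z (a true), which antipodality turns into c (a true + a false).
      rw [h1, hbd, hz, hloc (pull (a true)) (a false) fun l hl => hneg j (by omega) l hl true,
        ← map_add, hone]

theorem exists_zero_of_odd_l1 {n d : ℕ} (hd : d < n) (G : L1 n → Fin d → ℝ)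
    (hG : ContinuousOn G (Metric.sphere 0 1))
    (hodd : ∀ x ∈ Metric.sphere (0 : L1 n) 1, G (-x) = -G x) :
    ∃ x ∈ Metric.sphere (0 : L1 n) 1, G x = 0 := by
  by_contra! hne
  have hbase : basisVec ⟨0, by omega⟩ ∈ Metric.sphere (0 : L1 n) 1 := by
    rw [mem_sphere_zero_iff_norm, norm_basisVec]
  have hcpt : IsCompact (Metric.sphere (0 : L1 n) 1) := isCompact_sphere 0 1
  have : Nonempty (Fin d) := by
    by_contra h
    rw [not_nonempty_iff] at h
    exact hne _ hbase (Subsingleton.elim _ _)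
  obtain ⟨x₀, hx₀, hmin⟩ := hcpt.exists_isMinOn ⟨_, hbase⟩ hG.norm
  set δ := ‖G x₀‖ with hδ
  have hδ0 : 0 < δ := norm_pos_iff.2 (hne _ hx₀)
  -- The maximising index is chosen as a function of the vector of absolute values, so ties are
  -- broken in the same way at x and -x.
  have hmax : ∀ w : Fin d → ℝ, ∃ i, ∀ j, w j ≤ w i := fun w => Finite.exists_max w
  choose A hA using hmax
  let idx : L1 n → Fin d := fun x => A fun i => |G x i|
  have hidx : ∀ x ∈ Metric.sphere (0 : L1 n) 1, δ ≤ |G x (idx x)| := fun x hx =>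
    (hmin hx).trans ((pi_norm_le_iff_of_nonneg (abs_nonneg _)).2 fun j =>
      hA (fun i => |G x i|) j)
  have hidxneg : ∀ x ∈ Metric.sphere (0 : L1 n) 1, idx (-x) = idx x := fun x hx => by
    simp only [idx, hodd x hx, Pi.neg_apply, abs_neg]
  let lab : L1 n → Fin d ×ₗ Bool := fun x => toLex (idx x, decide (0 < G x (idx x)))
  have hlab : ∀ x ∈ Metric.sphere (0 : L1 n) 1, lab (-x) = opp (lab x) := fun x hx => by
    have h0 : G x (idx x) ≠ 0 := abs_pos.1 (hδ0.trans_le (hidx x hx))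
    simp only [lab, hidxneg x hx, hodd x hx, opp, ofLex_toLex, Pi.neg_apply]
    congr 2
    rcases lt_or_gt_of_ne h0 with h | h
    · simp [h, h.le]
    · simp [h, h.le]
  obtain ⟨η, hη, huc⟩ := Metric.uniformContinuousOn_iff.1
    (hcpt.uniformContinuousOn_of_continuous hG) δ hδ0
  obtain ⟨M, hM⟩ := exists_nat_gt (2 * (n : ℝ) / η)
  have hM0 : (0 : ℝ) < M := lt_of_le_of_lt (by positivity) hM
  have hMpos : 0 < M := by exact_mod_cast hM0
  have hcons : ∀ j < n, ∀ l, Small n M j l → Consistent (l.map lab) := by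
    rintro j hj l ⟨-, h2, h3⟩ X hX Y hY hXY
    obtain ⟨x, hx, rfl⟩ := List.mem_map.1 hX
    obtain ⟨y, hy, rfl⟩ := List.mem_map.1 hY
    have hxs : x ∈ Metric.sphere (0 : L1 n) 1 := mem_sphere_zero_iff_norm.2 (h2 x hx).1
    have hys : y ∈ Metric.sphere (0 : L1 n) 1 := mem_sphere_zero_iff_norm.2 (h2 y hy).1
    have hdist : dist x y < η := by
      rw [dist_eq_norm]
      refine (h3 x hx y hy).trans_lt ?_
      have hjn : (j : ℝ) ≤ n := by exact_mod_cast hj.le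
      rw [div_lt_iff₀ hη] at hM
      rw [div_lt_iff₀ hM0]
      linarith
    have hG' := huc x hxs y hys hdist
    have hi : idx x = idx y := hXY
    have hcoord : |G x (idx x) - G y (idx x)| < δ := by
      rw [← Real.dist_eq]
      exact (dist_le_pi_dist (G x) (G y) _).trans_lt hG'
    have hx' := hidx x hxs
    have hy' := hidx y hys
    rw [← hi] at hy'
    simp only [lab, ← hi]
    congr 2
    rw [decide_eq_decide]
    rw [abs_lt] at hcoord
    constructor
    · intro h
      by_contra h'
      rw [abs_of_pos h] at hx'
      linarith [not_lt.1 h']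
    · intro h
      by_contra h'
      rw [abs_of_pos h] at hy'
      linarith [not_lt.1 h']
  let a : Bool → List (L1 n) → ZMod 2 := fun s l => fan s (l.map lab)
  have hcob : ∀ j < n, ∀ l, Small n M j l → ∀ s, coboundary (a s) l = a s l + a (!s) l := by
    intro j hj l hl s
    rw [← coboundary_map lab (fan s), coboundary_fan (hcons j hj l hl)]
  have hneg : ∀ j < n, ∀ l, Small n M j l → ∀ s, a s (l.map fun v => -v) = a (!s) l := by
    intro j hj l hl s
    have h : (l.map fun v => -v).map lab = (l.map lab).map opp := by
      rw [List.map_map, List.map_map]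
      exact List.map_congr_left fun x hx => hlab x (mem_sphere_zero_iff_norm.2 (hl.2.1 x hx).1)
    simp only [a]
    rw [h, fan_map_opp (hcons j hj l hl)]
  obtain ⟨c, hloc, -, hone⟩ := exists_chain hMpos a (fun v => fan_singleton _) hneg hcob d hd
  have hvanish : ∀ l, Small n M d l → (a true + a false) l =
      (0 : List (L1 n) → ZMod 2) l := by
    intro l hl
    have h : ∀ s, a s l = 0 := fun s => by
      by_contra h
      have := length_le_of_fan_ne_zero h
      rw [List.length_map, hl.1, Fintype.card_fin] at this
      omega
    simp [h]
  rw [hloc _ _ hvanish, map_zero] at hone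
  exact zero_ne_one hone

/-- **Borsuk–Ulam**: an odd continuous map from the unit sphere of `ℝⁿ` to a real vector
space of dimension less than `n` has a zero. -/
theorem exists_zero_of_odd {n : ℕ} {ι : Type*} [Fintype ι] (hι : Fintype.card ι < n)
    (G : Metric.sphere (0 : EuclideanSpace ℝ (Fin n)) 1 → ι → ℝ) (hG : Continuous G)
    (hodd : ∀ x, G (-x) = -G x) : ∃ x, G x = 0 := by
  let e := Fintype.equivFin ι
  have hne : ∀ y : Metric.sphere (0 : L1 n) 1,
      (WithLp.toLp 2 (WithLp.ofLp y.1) : EuclideanSpace ℝ (Fin n)) ≠ 0 := by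
    intro y h
    have h0 : y.1 = 0 := by
      ext i
      simpa using congrArg (fun v : EuclideanSpace ℝ (Fin n) => v i) h
    have h1 := y.2
    rw [mem_sphere_zero_iff_norm, h0, norm_zero] at h1
    exact zero_ne_one h1
  let r : Metric.sphere (0 : L1 n) 1 → Metric.sphere (0 : EuclideanSpace ℝ (Fin n)) 1 :=
    fun y => ⟨‖(WithLp.toLp 2 (WithLp.ofLp y.1) : EuclideanSpace ℝ (Fin n))‖⁻¹ •
      WithLp.toLp 2 (WithLp.ofLp y.1), by
        rw [mem_sphere_zero_iff_norm, norm_smul, norm_inv, norm_norm,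
          inv_mul_cancel₀ (norm_ne_zero_iff.2 (hne y))]⟩
  have hto : Continuous fun y : Metric.sphere (0 : L1 n) 1 =>
      (WithLp.toLp 2 (WithLp.ofLp y.1) : EuclideanSpace ℝ (Fin n)) :=
    (PiLp.continuous_toLp 2 _).comp ((PiLp.continuous_ofLp 1 _).comp continuous_subtype_val)
  have hr : Continuous r :=
    Continuous.subtype_mk ((hto.norm.inv₀ fun y => norm_ne_zero_iff.2 (hne y)).smul hto) _
  have hrneg : ∀ y, r (-y) = -r y := fun y => Subtype.ext <| by simp [r]
  classical
  let G' : L1 n → Fin (Fintype.card ι) → ℝ := fun y i =>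
    if h : y ∈ Metric.sphere (0 : L1 n) 1 then G (r ⟨y, h⟩) (e.symm i) else 0
  have hval : ∀ y : Metric.sphere (0 : L1 n) 1, G' y = fun i => G (r y) (e.symm i) :=
    fun y => funext fun i => dif_pos y.2
  obtain ⟨y, hy, h⟩ := exists_zero_of_odd_l1 hι G' (by
      rw [continuousOn_iff_continuous_domRestrict]
      have : (Metric.sphere (0 : L1 n) 1).domRestrict G' = fun y i => G (r y) (e.symm i) :=
        funext hval
      rw [this]
      exact continuous_pi fun i => (continuous_apply _).comp (hG.comp hr)) (by
      intro y hy
      have h1 := hval ⟨y, hy⟩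
      have h2 := hval (-⟨y, hy⟩)
      rw [hrneg, hodd] at h2
      refine h2.trans ?_
      rw [h1]
      rfl)
  refine ⟨r ⟨y, hy⟩, funext fun i => ?_⟩
  have := congrFun h (e i)
  rw [hval ⟨y, hy⟩] at this
  simpa using this

end BorsukUlam

/-! ### Odd fields of orthonormal frames -/

namespace OrthogonalBisection

/-- A section of the projectivised Stiefel bundle lifts to an odd field of orthonormal
frames on the sphere. -/
theorem HasSection.exists_odd_frame {k n : ℕ} (h : HasSection k n) :
    ∃ f : Sphere n → Fin k → E n, Continuous f ∧ (∀ x, Orthonormal ℝ (f x)) ∧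
      ∀ x, f (-x) = -f x := by
  obtain ⟨hk, σ, hσ, hsec⟩ := h
  let P : Fin n → Fin k → ModAntipode (Stiefel k n) → E n := fun a i =>
    Quotient.lift (fun v : Stiefel k n => (v.1 ⟨0, hk⟩) a • v.1 i) (by
      rintro v w (h | h)
      · rw [h]
      · subst h
        show _ = (-(v.1 ⟨0, hk⟩)) a • -(v.1 i)
        simp)
  have hP : ∀ a i, Continuous (P a i) := fun a i => by
    have hv : ∀ i, Continuous fun v : Stiefel k n => v.1 i := fun i =>
      (continuous_apply i).comp continuous_subtype_val
    exact Continuous.quotient_lift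
      (((EuclideanSpace.proj (𝕜 := ℝ) a).continuous.comp (hv ⟨0, hk⟩)).smul (hv i)) _
  let q : Sphere n → RP n := fun x => Quotient.mk _ x
  have hq : Continuous q := continuous_quotient_mk'
  have hqneg : ∀ x, q (-x) = q x := fun x =>
    (Quotient.sound (Or.inr rfl : (antipodalSetoid (Sphere n)).r x (-x))).symm
  let f : Sphere n → Fin k → E n := fun x i => ∑ a, x.1 a • P a i (σ (q x))
  have hf : ∀ x, ∃ v : Stiefel k n, ∃ ε : ℝ, (ε = 1 ∨ ε = -1) ∧ f x = ε • v.1 := by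
    intro x
    obtain ⟨v, hv⟩ := Quotient.exists_rep (σ (q x))
    have h1 : q (stiefelProj hk n v) = q x := by rw [← hsec (q x), ← hv]; rfl
    have h2 : x = stiefelProj hk n v ∨ x = -stiefelProj hk n v := Quotient.exact h1
    have hfx : f x = fun i => (inner ℝ (v.1 ⟨0, hk⟩) x.1 : ℝ) • v.1 i := by
      funext i
      have : ∀ a, P a i (σ (q x)) = (v.1 ⟨0, hk⟩) a • v.1 i := fun a => by rw [← hv]; rfl
      simp only [f, this, smul_smul, ← Finset.sum_smul, PiLp.inner_apply]
      rfl
    have hself : (inner ℝ (v.1 ⟨0, hk⟩) (v.1 ⟨0, hk⟩) : ℝ) = 1 := by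
      rw [real_inner_self_eq_norm_sq, v.2.1, one_pow]
    rcases h2 with h2 | h2
    · refine ⟨v, 1, Or.inl rfl, ?_⟩
      have : x.1 = v.1 ⟨0, hk⟩ := congrArg Subtype.val h2
      rw [hfx, this, hself]; rfl
    · refine ⟨v, -1, Or.inr rfl, ?_⟩
      have : x.1 = -v.1 ⟨0, hk⟩ := congrArg Subtype.val h2
      rw [hfx, this, inner_neg_right, hself]; rfl
  refine ⟨f, ?_, fun x => ?_, fun x => ?_⟩
  · refine continuous_pi fun i => continuous_finsetSum _ fun a _ => ?_
    have h1 := (hP a i).comp (hσ.comp hq)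
    have h2 : Continuous fun x : Sphere n => x.1 a :=
      (EuclideanSpace.proj (𝕜 := ℝ) a).continuous.comp continuous_subtype_val
    exact h2.smul h1
  · obtain ⟨v, ε, hε | hε, hx⟩ := hf x
    · rw [hx, hε, one_smul]; exact v.2
    · rw [hx, hε, neg_one_smul]; exact orthonormal_neg v.2
  · funext i
    simp [f, hqneg]

/-! ### The imbalance of a measure across a hyperplane -/

variable {n : ℕ}

/-- The difference of the measures of the two sides of the hyperplane `⟪y, u⟫ = b`. -/
noncomputable def imbalance (μ : Measure (E n)) (u : E n) (b : ℝ) : ℝ :=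
  ∫ y, Real.sign (b - inner ℝ y u) ∂μ

theorem measurable_sign_real : Measurable Real.sign :=
  Measurable.ite measurableSet_Iio measurable_const
    (Measurable.ite measurableSet_Ioi measurable_const measurable_const)

theorem monotone_sign_real : Monotone Real.sign := by
  intro a b hab
  simp only [Real.sign]
  split_ifs <;> first | (exfalso; linarith) | norm_num

theorem abs_sign_real_le (a : ℝ) : ‖Real.sign a‖ ≤ 1 := by
  rcases Real.sign_apply_eq a with h | h | h <;> simp [h]

theorem continuousAt_sign_real {a : ℝ} (ha : a ≠ 0) : ContinuousAt Real.sign a := by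
  rcases lt_or_gt_of_ne ha with h | h
  · refine (continuousAt_const (y := (-1 : ℝ))).congr ?_
    filter_upwards [eventually_lt_nhds h] with b hb
    rw [Real.sign_of_neg hb]
  · refine (continuousAt_const (y := (1 : ℝ))).congr ?_
    filter_upwards [eventually_gt_nhds h] with b hb
    rw [Real.sign_of_pos hb]

theorem volume_hyperplane {u : E n} (hu : u ≠ 0) (b : ℝ) :
    volume {y : E n | inner ℝ y u = b} = 0 := by
  let A : AffineSubspace ℝ (E n) :=
    (AffineSubspace.mk' b (⊥ : Submodule ℝ ℝ)).comap (innerSL ℝ u).toLinearMap.toAffineMap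
  have hmem : ∀ y, y ∈ A ↔ inner ℝ y u = b := fun y => by
    simp [A, AffineSubspace.mem_comap, AffineSubspace.mem_mk', sub_eq_zero, real_inner_comm]
  have hA : A ≠ ⊤ := by
    intro h
    have h0 := (hmem 0).1 (h ▸ AffineSubspace.mem_top ℝ (E n) 0)
    have h1 := (hmem u).1 (h ▸ AffineSubspace.mem_top ℝ (E n) u)
    rw [inner_zero_left] at h0
    rw [← h0] at h1
    exact hu (inner_self_eq_zero.1 h1)
  have := Measure.addHaar_affineSubspace volume A hA
  rwa [show (A : Set (E n)) = {y : E n | inner ℝ y u = b} from Set.ext hmem] at this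

theorem measurable_imbalance_integrand (u : E n) (b : ℝ) :
    Measurable fun y : E n => Real.sign (b - inner ℝ y u) :=
  measurable_sign_real.comp (by fun_prop)

theorem integrable_imbalance (μ : Measure (E n)) [IsFiniteMeasure μ] (u : E n) (b : ℝ) :
    Integrable (fun y : E n => Real.sign (b - inner ℝ y u)) μ :=
  Integrable.of_bound (measurable_imbalance_integrand u b).aestronglyMeasurable 1
    (Filter.Eventually.of_forall fun _ => abs_sign_real_le _)

theorem imbalance_neg (μ : Measure (E n)) (u : E n) (b : ℝ) :
    imbalance μ (-u) (-b) = -imbalance μ u b := by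
  rw [imbalance, imbalance, ← integral_neg]
  refine integral_congr_ae (Filter.Eventually.of_forall fun y => ?_)
  show Real.sign (-b - inner ℝ y (-u)) = -Real.sign (b - inner ℝ y u)
  rw [← Real.sign_neg, inner_neg_right]
  congr 1; ring

theorem imbalance_mono (μ : Measure (E n)) [IsFiniteMeasure μ] (u : E n) :
    Monotone (imbalance μ u) := fun b b' hb =>
  integral_mono (integrable_imbalance μ u b) (integrable_imbalance μ u b') fun _ =>
    monotone_sign_real (sub_le_sub_right hb _)

theorem continuous_imbalance {μ : Measure (E n)} (hμ : IsMassDistribution μ) :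
    Continuous fun p : Sphere n × ℝ => imbalance μ p.1.1 p.2 := by
  have := hμ.finite
  rw [continuous_iff_continuousAt]
  rintro ⟨u, b⟩
  refine continuousAt_of_dominated (bound := fun _ => 1)
    (Filter.Eventually.of_forall fun p =>
      (measurable_imbalance_integrand p.1.1 p.2).aestronglyMeasurable)
    (Filter.Eventually.of_forall fun p => Filter.Eventually.of_forall fun _ =>
      abs_sign_real_le _) (integrable_const 1) ?_
  have hu : u.1 ≠ 0 := ne_zero_of_mem_unit_sphere u
  have hnull : ∀ᵐ y ∂μ, ¬ inner ℝ y u.1 = b :=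
    measure_eq_zero_iff_ae_notMem.1 (hμ.absolutelyContinuous (volume_hyperplane hu b))
  filter_upwards [hnull] with y hy
  have hc : ContinuousAt (fun p : Sphere n × ℝ => p.2 - inner ℝ y p.1.1) (u, b) := by
    fun_prop
  exact ContinuousAt.comp (g := Real.sign)
    (continuousAt_sign_real (sub_ne_zero.2 fun h => hy h.symm)) hc

theorem imbalance_eq_sub (μ : Measure (E n)) [IsFiniteMeasure μ] (H : Hyperplane n) :
    imbalance μ H.normal.1 H.offset = μ.real H.negSide - μ.real H.posSide := by
  have hn : MeasurableSet H.negSide := measurableSet_le (by fun_prop) measurable_const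
  have hp : MeasurableSet H.posSide := measurableSet_le measurable_const (by fun_prop)
  rw [← integral_indicator_one hn, ← integral_indicator_one hp, ← integral_sub
    ((integrable_const 1).indicator hn) ((integrable_const 1).indicator hp)]
  refine integral_congr_ae (Filter.Eventually.of_forall fun y => ?_)
  show Real.sign (H.offset - inner ℝ y H.normal.1) =
    H.negSide.indicator 1 y - H.posSide.indicator 1 y
  rcases lt_trichotomy (inner ℝ y H.normal.1) H.offset with h | h | h
  · rw [Set.indicator_of_mem (show y ∈ H.negSide from h.le),
      Set.indicator_of_notMem (show y ∉ H.posSide from not_le.2 h),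
      Real.sign_of_pos (sub_pos.2 h)]
    simp
  · rw [Set.indicator_of_mem (show y ∈ H.negSide from h.le),
      Set.indicator_of_mem (show y ∈ H.posSide from h.ge), h]
    simp
  · rw [Set.indicator_of_notMem (show y ∉ H.negSide from not_le.2 h),
      Set.indicator_of_mem (show y ∈ H.posSide from h.le), Real.sign_of_neg (sub_neg.2 h)]
    simp

theorem bisects_of_imbalance_eq_zero {μ : Measure (E n)} (hμ : IsMassDistribution μ)
    {H : Hyperplane n} (h : imbalance μ H.normal.1 H.offset = 0) : H.Bisects μ := by
  have := hμ.finite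
  have hn : MeasurableSet H.negSide := measurableSet_le (by fun_prop) measurable_const
  have heq : μ H.negSide = μ H.posSide := by
    rw [imbalance_eq_sub, sub_eq_zero] at h
    exact (measureReal_eq_measureReal_iff).1 h
  have hu : H.normal.1 ≠ 0 := ne_zero_of_mem_unit_sphere H.normal
  have hinter : μ (H.posSide ∩ H.negSide) = 0 := by
    refine measure_mono_null ?_ (hμ.absolutelyContinuous (volume_hyperplane hu H.offset))
    exact fun y hy => le_antisymm hy.2 hy.1
  have hunion : H.posSide ∪ H.negSide = Set.univ :=
    Set.eq_univ_of_forall fun y => le_total H.offset (inner ℝ y H.normal.1)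
  have hsum := measure_union_add_inter (μ := μ) H.posSide hn
  rw [hinter, hunion, add_zero, heq, ← two_mul] at hsum
  have hhalf : μ H.posSide = μ Set.univ / 2 := by
    rw [hsum, mul_comm, ENNReal.mul_div_cancel_right two_ne_zero ENNReal.ofNat_ne_top]
  exact ⟨hhalf, heq.trans hhalf⟩

/-- Beyond a radius `R` independent of the direction, at least half of the mass lies on the
negative side. -/
theorem exists_radius (μ : Measure (E n)) [IsFiniteMeasure μ] :
    ∃ R : ℝ, 0 ≤ R ∧ ∀ u : Sphere n, ∀ b, R < b → 0 ≤ imbalance μ u.1 b := by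
  have hlim : Filter.Tendsto (fun N : ℕ => ∫ y : E n, Real.sign ((N : ℝ) - ‖y‖) ∂μ)
      Filter.atTop (nhds (∫ _ : E n, (1 : ℝ) ∂μ)) := by
    refine tendsto_integral_of_dominated_convergence (fun _ => 1)
      (fun N => (measurable_sign_real.comp (by fun_prop)).aestronglyMeasurable)
      (integrable_const 1)
      (fun N => Filter.Eventually.of_forall fun _ => abs_sign_real_le _)
      (Filter.Eventually.of_forall fun y => ?_)
    refine tendsto_const_nhds.congr' ?_
    obtain ⟨M, hM⟩ := exists_nat_gt ‖y‖
    filter_upwards [Filter.eventually_ge_atTop M] with N hN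
    have : (M : ℝ) ≤ N := by exact_mod_cast hN
    rw [Real.sign_of_pos (by linarith)]
  have hex : ∃ N : ℕ, 0 ≤ ∫ y : E n, Real.sign ((N : ℝ) - ‖y‖) ∂μ := by
    rcases eq_or_ne μ 0 with rfl | hμ
    · exact ⟨0, by simp⟩
    · have hpos : 0 < ∫ _ : E n, (1 : ℝ) ∂μ := by
        have : NeZero μ := ⟨hμ⟩
        rw [integral_const, smul_eq_mul, mul_one]
        exact measureReal_univ_pos
      exact ((hlim.eventually_const_lt hpos).exists).imp fun _ h => h.le
  obtain ⟨N, hN⟩ := hex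
  refine ⟨N, N.cast_nonneg, fun u b hb => hN.trans (integral_mono ?_
    (integrable_imbalance μ u.1 b) fun y => monotone_sign_real ?_)⟩
  · exact Integrable.of_bound
      (measurable_sign_real.comp (by fun_prop)).aestronglyMeasurable 1
      (Filter.Eventually.of_forall fun _ => abs_sign_real_le _)
  · have h1 := real_inner_le_norm y u.1
    rw [norm_eq_of_mem_sphere, mul_one] at h1
    linarith

/-- A continuous odd choice of approximately median hyperplanes, one in each direction. -/
theorem exists_approx_median {μ : Measure (E n)} (hμ : IsMassDistribution μ) {R : ℝ}
    (hR : ∀ u : Sphere n, ∀ b, R < b → 0 ≤ imbalance μ u.1 b) (hR0 : 0 ≤ R) {ε : ℝ}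
    (hε : 0 < ε) : ∃ β : Sphere n → ℝ, Continuous β ∧ (∀ u, β (-u) = -β u) ∧
      (∀ u, |β u| ≤ R) ∧ ∀ u, imbalance μ u.1 (β u) + ε * β u = 0 := by
  have := hμ.finite
  let φ : Sphere n → ℝ → ℝ := fun u b => imbalance μ u.1 b + ε * b
  have hφ : Continuous fun p : Sphere n × ℝ => φ p.1 p.2 :=
    (continuous_imbalance hμ).add (continuous_const.mul continuous_snd)
  have hmono : ∀ u, StrictMono (φ u) := fun u =>
    (imbalance_mono μ u.1).add_strictMono fun _ _ h => mul_lt_mul_of_pos_left h hε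
  have hodd : ∀ u b, φ (-u) (-b) = -φ u b := fun u b => by
    have := imbalance_neg μ u.1 b
    simp only [φ]
    rw [show ((-u : Sphere n) : E n) = -u.1 from rfl, this]; ring
  have hpos : ∀ u b, R < b → 0 < φ u b := fun u b hb =>
    add_pos_of_nonneg_of_pos (hR u b hb) (mul_pos hε (hR0.trans_lt hb))
  have hneg : ∀ u b, b < -R → φ u b < 0 := fun u b hb => by
    have h1 := hpos (-u) (-b) (by linarith)
    rw [hodd] at h1
    linarith
  have hzero : ∀ u, ∃ b, φ u b = 0 := fun u => by
    have hc : Continuous (φ u) := hφ.comp (Continuous.prodMk continuous_const continuous_id)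
    obtain ⟨b, -, hb⟩ := intermediate_value_Icc (by linarith : -R - 1 ≤ R + 1) hc.continuousOn
      ⟨(hneg u (-R - 1) (by linarith)).le, (hpos u (R + 1) (by linarith)).le⟩
    exact ⟨b, hb⟩
  choose β hβ using hzero
  refine ⟨β, ?_, fun u => ?_, fun u => ?_, hβ⟩
  · rw [continuous_iff_continuousAt]
    intro u
    rw [Metric.continuousAt_iff']
    intro η hη
    have hc : ∀ b, Continuous fun v => φ v b := fun b =>
      hφ.comp (Continuous.prodMk continuous_id continuous_const)
    have h1 : φ u (β u - η) < 0 := by rw [← hβ u]; exact hmono u (by linarith)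
    have h2 : 0 < φ u (β u + η) := by
      conv_lhs => rw [← hβ u]
      exact hmono u (by linarith)
    filter_upwards [(hc _).continuousAt.eventually_lt_const h1,
      (hc _).continuousAt.eventually_const_lt h2] with v hv1 hv2
    rw [← hβ v] at hv1 hv2
    rw [Real.dist_eq, abs_lt]
    have h3 := (hmono v).lt_iff_lt.1 hv1
    have h4 := (hmono v).lt_iff_lt.1 hv2
    constructor <;> linarith
  · apply (hmono (-u)).injective
    rw [hβ, hodd, hβ, neg_zero]
  · rw [abs_le]
    constructor
    · by_contra! h
      exact (hneg u _ h).ne (hβ u)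
    · by_contra! h
      exact (hpos u _ h).ne' (hβ u)

theorem orthogonallyBisectable_of_frame {k m : ℕ} (hk : k * m < n)
    {f : Sphere n → Fin k → E n} (hf : Continuous f) (horth : ∀ x, Orthonormal ℝ (f x))
    (hodd : ∀ x, f (-x) = -f x) : OrthogonallyBisectable k (m + 1) n := by
  intro μ hμ
  have := (hμ 0).finite
  let F : Fin k → Sphere n → Sphere n := fun i x => ⟨f x i, by simpa using (horth x).1 i⟩
  have hF : ∀ i, Continuous (F i) := fun i =>
    Continuous.subtype_mk ((continuous_apply i).comp hf) _
  have hFneg : ∀ i x, F i (-x) = -F i x := fun i x =>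
    Subtype.ext (congrFun (hodd x) i)
  obtain ⟨R, hR0, hR⟩ := exists_radius (μ 0)
  let Q : Sphere n × (Fin k → ℝ) → ℝ := fun p =>
    ∑ i, ∑ j, |imbalance (μ j) (F i p.1).1 (p.2 i)|
  have hQ : Continuous Q := by
    refine continuous_finsetSum _ fun i _ => continuous_finsetSum _ fun j _ => ?_
    exact ((continuous_imbalance (hμ j)).comp (Continuous.prodMk ((hF i).comp continuous_fst)
      ((continuous_apply i).comp continuous_snd))).abs
  have happrox : ∀ ε > 0, ∃ p : Sphere n × (Fin k → ℝ),
      p ∈ Set.univ ×ˢ Set.univ.pi (fun _ : Fin k => Set.Icc (-R) R) ∧ Q p ≤ k * (ε * R) := by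
    intro ε hε
    obtain ⟨β, hβ, hβneg, hβR, hβ0⟩ := exists_approx_median (hμ 0) hR hR0 hε
    obtain ⟨x, hx⟩ := BorsukUlam.exists_zero_of_odd (n := n) (ι := Fin k × Fin m)
      (by simpa using hk)
      (fun x p => imbalance (μ p.2.succ) (F p.1 x).1 (β (F p.1 x)))
      (continuous_pi fun p => (continuous_imbalance (hμ _)).comp
        (Continuous.prodMk (hF p.1) (hβ.comp (hF p.1))))
      (fun x => funext fun p => by
        rw [hFneg, hβneg]; exact imbalance_neg _ _ _)
    refine ⟨(x, fun i => β (F i x)), ?_, ?_⟩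
    · simp only [Set.mem_prod, Set.mem_univ, Set.mem_pi, true_and, true_implies]
      exact fun i => abs_le.1 (hβR _)
    · calc Q (x, fun i => β (F i x)) ≤ ∑ _i : Fin k, ε * R := Finset.sum_le_sum fun i _ => by
            rw [Fin.sum_univ_succ, Finset.sum_eq_zero, add_zero]
            · rw [eq_neg_of_add_eq_zero_left (hβ0 (F i x)), abs_neg, abs_mul, abs_of_pos hε]
              exact mul_le_mul_of_nonneg_left (hβR _) hε.le
            · intro j _
              rw [show imbalance (μ j.succ) (F i x).1 (β (F i x)) = 0 from congrFun hx (i, j),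
                abs_zero]
        _ = k * (ε * R) := by simp
  have hcpt : IsCompact ((Set.univ : Set (Sphere n)) ×ˢ
      Set.univ.pi (fun _ : Fin k => Set.Icc (-R) R)) :=
    isCompact_univ.prod (isCompact_univ_pi fun _ => isCompact_Icc)
  obtain ⟨p₁, hp₁, -⟩ := happrox 1 one_pos
  obtain ⟨p, -, hmin⟩ := hcpt.exists_isMinOn ⟨p₁, hp₁⟩ hQ.continuousOn
  have hQ0 : Q p ≤ 0 := by
    by_contra! h
    have hden : 0 < (k : ℝ) * R + 1 := by positivity
    obtain ⟨p', hp', hle⟩ := happrox (Q p / (k * R + 1)) (div_pos h hden)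
    have h1 : Q p ≤ Q p' := hmin hp'
    have h2 : (k : ℝ) * (Q p / (k * R + 1) * R) = Q p - Q p / (k * R + 1) := by
      field_simp; ring
    have h3 := div_pos h hden
    linarith
  have hzero : ∀ i j, imbalance (μ j) (F i p.1).1 (p.2 i) = 0 := by
    have hnn : ∀ i, 0 ≤ ∑ j, |imbalance (μ j) (F i p.1).1 (p.2 i)| := fun i =>
      Finset.sum_nonneg fun j _ => abs_nonneg _
    have h0 : Q p = 0 := le_antisymm hQ0 (Finset.sum_nonneg fun i _ => hnn i)
    intro i j
    have h1 := (Finset.sum_eq_zero_iff_of_nonneg fun i _ => hnn i).1 h0 i (Finset.mem_univ i)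
    have h2 := (Finset.sum_eq_zero_iff_of_nonneg fun j _ => abs_nonneg _).1 h1 j
      (Finset.mem_univ j)
    exact abs_eq_zero.1 h2
  exact ⟨fun i => ⟨F i p.1, p.2 i⟩, fun i i' hne => (horth p.1).2 hne,
    fun i j => bisects_of_imbalance_eq_zero (hμ j) (hzero i j)⟩

end OrthogonalBisection

/-- The quotient `(n - 1) / (m - 1)` is rounded down (division in `ℕ`) and read as `+∞` when
`m = 1`. -/
theorem theorem2p1 (m n k : ℕ) (hm : 1 ≤ m) (hn : 1 ≤ n)
    (hk : k = if m = 1 then OrthogonalBisection.rho n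
      else min (OrthogonalBisection.rho n) ((n - 1) / (m - 1))) :
    (∀ μ : Fin m → MeasureTheory.Measure (EuclideanSpace ℝ (Fin n)),
      (∀ j, OrthogonalBisection.IsMassDistribution (μ j)) →
        ∃ H : Fin k → OrthogonalBisection.Hyperplane n,
          (∀ i i', i ≠ i' → (H i).Orthogonal (H i')) ∧ ∀ i j, (H i).Bisects (μ j)) ∧
    k ≤ OrthogonalBisection.omegaPerp m n := by
  obtain ⟨m, rfl⟩ : ∃ m', m = m' + 1 := ⟨m - 1, by omega⟩
  have hkrho : k ≤ OrthogonalBisection.rho n := by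
    rw [hk]; split_ifs
    · exact le_rfl
    · exact min_le_left _ _
  have hkm : k * m < n := by
    rcases Nat.eq_zero_or_pos m with rfl | hm0
    · omega
    · rw [if_neg (by omega), Nat.add_sub_cancel] at hk
      have h1 : k ≤ (n - 1) / m := hk ▸ min_le_right _ _
      have h2 := (Nat.le_div_iff_mul_le hm0).1 h1
      omega
  obtain ⟨f, hf, horth, hodd⟩ := (OrthogonalBisection.isGreatest_rho hn).1.exists_odd_frame
  have key : OrthogonalBisection.OrthogonallyBisectable k (m + 1) n :=
    OrthogonalBisection.orthogonallyBisectable_of_frame hkm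
      (f := fun x i => f x (Fin.castLE hkrho i))
      (continuous_pi fun i => (continuous_apply _).comp hf)
      (fun x => (horth x).comp _ (Fin.castLE_injective hkrho))
      (fun x => funext fun i => congrFun (hodd x) _)
  exact ⟨key, (OrthogonalBisection.isGreatest_omegaPerp (m + 1) n).2 key⟩
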